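/- Let $N\ge 1$ and let $\mathbb Z_N=\mathbb Z/N\mathbb Z$. For $T\subseteq\mathbb Z_N$ and $y\in\mathbb Z_N$ put $\nu_T(y)=\#\{(t,t')\in T\times T: t-t'=y\}$. Two nonempty subsets $S,T\subseteq\mathbb Z_N$ are called \emph{formally dual} if \[\left|\frac1{|S|}\sum_{x\in S}e^{2\pi i xy/N}\right|^2=\frac1{|T|}\,\nu_T(y)\qquad\text{for every }y\in\mathbb Z_N.\] A subset of $\mathbb Z_N$ is called \emph{primitive} if it is not contained in any coset of a proper subgroup of $\mathbb Z_N$. \textbf{Proposition.} Let $N=p^2q^2$, where $p$ and $q$ are distinct primes. Then $\mathbb Z_N$ does not have primitive formally dual subsets; that is, there are no primitive subsets $S,T\subseteq\mathbb Z_N$ that are formally dual. -/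

import Mathlib

/-- The weight enumerator (difference function) of a finite set `T` in an abelian group:
the number of pairs `(t, t') ∈ T × T` with `t - t' = y`. -/
def weightEnumerator {G : Type*} [AddCommGroup G] [DecidableEq G] (T : Finset G) (y : G) : ℕ :=
  ((T ×ˢ T).filter fun z => z.1 - z.2 = y).card

/-- `S` is primitive if it is not contained in any coset of a proper subgroup. -/
def IsPrimitiveSubset {G : Type*} [AddCommGroup G] (S : Finset G) : Prop :=
  ∀ (H : AddSubgroup G), H ≠ ⊤ → ∀ a : G, ¬ ∀ x ∈ S, x - a ∈ H

/-- Formal duality of two (nonempty) subsets of `ℤ/N`, where `y : ZMod N` stands for the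
character `x ↦ exp (2πi x y / N)`, and `ZMod.stdAddChar x = exp (2πi x / N)`. -/
def FormallyDual {N : ℕ} [NeZero N] (S T : Finset (ZMod N)) : Prop :=
  S.Nonempty ∧ T.Nonempty ∧
    ∀ y : ZMod N,
      ‖(1 / (S.card : ℂ)) * ∑ x ∈ S, (ZMod.stdAddChar (x * y) : ℂ)‖ ^ 2 =
        1 / (T.card : ℝ) * (weightEnumerator T y : ℝ)

/-!
Write `ν_T` for the difference function of `T`, and let `S`, `T` be primitive and formally dual in
`ZMod N` with `N = p² q²`. Fourier inversion shows that formal duality is symmetric and that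
`|S| |T| = N`. The values `|Ŝ(y)|² = |S|² ν_T(y) / |T|` are rational algebraic integers; hence they
are integers, and by Galois invariance `ν_S` and `ν_T` are invariant under multiplication by units.
If `S` were invariant under a translation, then `Ŝ` would be supported on a proper subgroup, and `T`
would not be primitive (`FormallyDual.not_isPrimitiveSubset_of_periodic`).

Counting differences modulo `p²` and `q²`, together with integrality, leaves only the case
`|S| = |T| = p q` (`FormallyDual.card_eq_mul`).

In that case, `Ŝ` does not vanish at the units. If it did, `S` would be a disjoint union of cosets
of the subgroups of order `p` and `q`, and as `|S| = p q` only one kind could occur, making `S`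
periodic (`FormallyDual.weightEnumerator_unit_pos`). Thus every unit is a difference of `S` and
of `T`. Let `w_S` be the number of pairs in `S × S` whose difference is congruent to a given unit
modulo `q²`, and `c_T` the value of `ν_T` at the elements of order `q`. Poisson summation gives
`q w_S + p c_T = p² q` (`FormallyDual.mul_foldedEnumerator_one`), and `w_S ≥ p² - p` because
`p² - p` units of `ZMod N` lie over each unit modulo `q²`. So `c_T` is `0` or
`q`, and likewise `c_S`.

* If `c_T = 0`, then `w_S = p²` and `S` is equally distributed modulo `q`. For odd `q`, the sum of
  `(s - t) ^ (q - 1)` over all pairs, taken modulo `q²`, is `-2 p² q` by the binomial theorem and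
  `-p² q` by grouping equal differences, which is impossible. So `q = 2`.
* If `c_T = q`, then `w_S = p² - p` leaves no room for a difference prime to `q` that is not a unit.
  By duality `T̂` vanishes at the characters of order `q²`, which makes the distribution of `T`
  modulo `q²` invariant under translation by `q`. Hence `q` divides `w_T ∈ {p², p² - p}`, that is,
  `q ∣ p - 1`.

So `q = 2` or `q ∣ p - 1`, and by symmetry `p = 2` or `p ∣ q - 1`. No two distinct primes satisfy
both.
-/

open Finset

/-! ### Difference functions and exponential sums -/

/-- The exponential sum `∑ x ∈ S, exp (2πi x y / N)`, that is, the Fourier transform at `y` of the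
indicator function of `S`. -/
noncomputable def charSum {N : ℕ} [NeZero N] (S : Finset (ZMod N)) (y : ZMod N) : ℂ :=
  ∑ x ∈ S, (ZMod.stdAddChar (x * y) : ℂ)

section WeightEnumerator

variable {G : Type*} [AddCommGroup G] [DecidableEq G] {S : Finset G}

lemma sum_sum_sub_eq_sum_weightEnumerator [Fintype G] {M : Type*} [AddCommMonoid M]
    (S : Finset G) (F : G → M) :
    ∑ s ∈ S, ∑ t ∈ S, F (s - t) = ∑ y, weightEnumerator S y • F y := by
  rw [← sum_product', ← sum_fiberwise (S ×ˢ S) (fun z => z.1 - z.2)]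
  refine sum_congr rfl fun y _ => ?_
  rw [weightEnumerator, ← sum_const]
  exact sum_congr rfl fun z hz => by rw [(mem_filter.1 hz).2]

lemma weightEnumerator_pos_iff {y : G} :
    0 < weightEnumerator S y ↔ ∃ s ∈ S, ∃ t ∈ S, s - t = y := by
  simp only [weightEnumerator, card_pos, Finset.Nonempty, mem_filter, mem_product, Prod.exists]
  exact ⟨fun ⟨a, b, h, e⟩ => ⟨a, h.1, b, h.2, e⟩, fun ⟨a, h, b, h', e⟩ => ⟨a, b, ⟨h, h'⟩, e⟩⟩

/-- The number of ways to write `y` as a difference of elements of `S` counts the elements of `S`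
that stay in `S` when `y` is added to them. -/
lemma weightEnumerator_eq_card_filter (S : Finset G) (y : G) :
    weightEnumerator S y = (S.filter fun x => x + y ∈ S).card := by
  rw [weightEnumerator]
  refine card_bij (fun z _ => z.2) ?_ ?_ ?_
  · rintro ⟨a, b⟩ h
    simp only [mem_filter, mem_product] at h ⊢
    refine ⟨h.1.2, ?_⟩
    rw [← h.2]; simpa using h.1.1
  · rintro ⟨a, b⟩ h ⟨a', b'⟩ h' e
    simp only [mem_filter, mem_product] at h h' e
    subst e
    rw [Prod.mk.injEq]
    exact ⟨by rw [← sub_left_inj (a := b), h.2, h'.2], rfl⟩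
  · intro b hb
    rw [mem_filter] at hb
    exact ⟨(b + y, b), by simp [hb.1, hb.2], rfl⟩

lemma weightEnumerator_zero (S : Finset G) : weightEnumerator S 0 = S.card := by
  simp [weightEnumerator_eq_card_filter]

lemma weightEnumerator_neg (S : Finset G) (y : G) :
    weightEnumerator S (-y) = weightEnumerator S y := by
  refine card_bij (fun z _ => (z.2, z.1)) ?_ ?_ ?_
  · rintro ⟨a, b⟩ h
    simp only [mem_filter, mem_product] at h ⊢
    exact ⟨h.1.symm, by rw [← neg_sub, h.2, neg_neg]⟩
  · rintro ⟨a, b⟩ h ⟨a', b'⟩ h' e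
    simpa [and_comm] using e
  · rintro ⟨a, b⟩ h
    simp only [mem_filter, mem_product] at h
    refine ⟨(b, a), ?_, rfl⟩
    simp only [mem_filter, mem_product]
    exact ⟨h.1.symm, by rw [← h.2]; abel⟩

lemma weightEnumerator_le_card (S : Finset G) (y : G) : weightEnumerator S y ≤ S.card :=
  weightEnumerator_eq_card_filter S y ▸ card_filter_le _ _

lemma add_mem_of_weightEnumerator_eq_card {y : G} (h : weightEnumerator S y = S.card) {x : G}
    (hx : x ∈ S) : x + y ∈ S := by
  rw [weightEnumerator_eq_card_filter] at h
  exact (card_filter_eq_iff.1 h) x hx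

lemma sum_weightEnumerator [Fintype G] (S : Finset G) :
    ∑ y, weightEnumerator S y = S.card ^ 2 := by
  simpa [sq] using (sum_sum_sub_eq_sum_weightEnumerator S (fun _ => (1 : ℕ))).symm

end WeightEnumerator

section CharSum

variable {N : ℕ} [NeZero N] {S T : Finset (ZMod N)}

lemma normSq_charSum (S : Finset (ZMod N)) (y : ZMod N) :
    ((‖charSum S y‖ ^ 2 : ℝ) : ℂ) = ∑ s ∈ S, ∑ t ∈ S, (ZMod.stdAddChar ((s - t) * y) : ℂ) := by
  push_cast
  rw [← Complex.mul_conj', charSum, map_sum, sum_mul_sum]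
  refine sum_congr rfl fun s _ => sum_congr rfl fun t _ => ?_
  rw [← AddChar.map_neg_eq_conj, ← AddChar.map_add_eq_mul]
  congr 1; ring

lemma normSq_charSum_eq_sum_weightEnumerator (S : Finset (ZMod N)) (y : ZMod N) :
    ((‖charSum S y‖ ^ 2 : ℝ) : ℂ) =
      ∑ x, (weightEnumerator S x : ℂ) * (ZMod.stdAddChar (x * y) : ℂ) := by
  rw [normSq_charSum,
    sum_sum_sub_eq_sum_weightEnumerator S (fun z => (ZMod.stdAddChar (z * y) : ℂ))]
  simp

lemma sum_stdAddChar_mul (x : ZMod N) :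
    ∑ y, (ZMod.stdAddChar (x * y) : ℂ) = if x = 0 then (N : ℂ) else 0 := by
  have := AddChar.sum_mulShift (R' := ℂ) x (ZMod.isPrimitive_stdAddChar N)
  simp only [mul_comm _ x, ZMod.card] at this
  simpa using this

lemma sum_normSq_charSum_mul (S : Finset (ZMod N)) (x : ZMod N) :
    ∑ y, ((‖charSum S y‖ ^ 2 : ℝ) : ℂ) * (ZMod.stdAddChar (y * x) : ℂ) =
      N * weightEnumerator S (-x) := by
  simp_rw [normSq_charSum_eq_sum_weightEnumerator, sum_mul]
  rw [sum_comm]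
  have (z : ZMod N) : ∑ y, (weightEnumerator S z : ℂ) * (ZMod.stdAddChar (z * y) : ℂ) *
      (ZMod.stdAddChar (y * x) : ℂ) = if z = -x then (N : ℂ) * weightEnumerator S (-x) else 0 := by
    simp_rw [mul_assoc, ← AddChar.map_add_eq_mul, mul_comm _ x, ← add_mul]
    rw [← mul_sum, sum_stdAddChar_mul]
    simp only [← eq_neg_iff_add_eq_zero]
    split_ifs with h
    · rw [h, mul_comm]
    · simp
  simp_rw [this]
  simp

namespace FormallyDual

lemma card_ne_zero_left (h : FormallyDual S T) : (S.card : ℝ) ≠ 0 := by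
  exact_mod_cast h.1.card_pos.ne'

lemma card_ne_zero_right (h : FormallyDual S T) : (T.card : ℝ) ≠ 0 := by
  exact_mod_cast h.2.1.card_pos.ne'

lemma normSq_charSum_mul_card (h : FormallyDual S T) (y : ZMod N) :
    ‖charSum S y‖ ^ 2 * T.card = S.card ^ 2 * weightEnumerator T y := by
  have h1 := h.2.2 y
  have hS := h.card_ne_zero_left
  have hT := h.card_ne_zero_right
  rw [norm_mul, mul_pow, norm_div, norm_one, Complex.norm_natCast] at h1
  change _ * ‖charSum S y‖ ^ 2 = _ at h1
  field_simp at h1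
  linarith

lemma normSq_charSum_eq (h : FormallyDual S T) (y : ZMod N) :
    ‖charSum S y‖ ^ 2 = S.card ^ 2 * weightEnumerator T y / T.card := by
  rw [eq_div_iff h.card_ne_zero_right, h.normSq_charSum_mul_card]

lemma card_mul_card (h : FormallyDual S T) : S.card * T.card = N := by
  have h1 := sum_normSq_charSum_mul S 0
  simp only [mul_zero, AddChar.map_zero_eq_one, mul_one, neg_zero, weightEnumerator_zero] at h1
  norm_cast at h1
  have hS := h.card_ne_zero_left
  have hT := h.card_ne_zero_right
  simp_rw [h.normSq_charSum_eq] at h1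
  rw [← sum_div, ← mul_sum, ← Nat.cast_sum, sum_weightEnumerator] at h1
  push_cast at h1
  field_simp at h1
  exact_mod_cast h1

lemma symm (h : FormallyDual S T) : FormallyDual T S := by
  refine ⟨h.2.1, h.1, fun y => ?_⟩
  have hS := h.card_ne_zero_left
  have hT := h.card_ne_zero_right
  change ‖_ * charSum T y‖ ^ 2 = _
  rw [norm_mul, mul_pow, norm_div, norm_one, Complex.norm_natCast]
  have h1 := sum_normSq_charSum_mul S y
  rw [weightEnumerator_neg] at h1
  have h2 := normSq_charSum_eq_sum_weightEnumerator T y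
  have h3 : (S.card ^ 2 / T.card : ℝ) * ‖charSum T y‖ ^ 2 = N * weightEnumerator S y := by
    apply Complex.ofReal_injective
    rw [Complex.ofReal_mul, h2, Complex.ofReal_mul, Complex.ofReal_natCast, Complex.ofReal_natCast,
      ← h1, mul_sum]
    refine sum_congr rfl fun x _ => ?_
    rw [h.normSq_charSum_eq]
    push_cast
    ring
  have hN : (N : ℝ) = S.card * T.card := by exact_mod_cast h.card_mul_card.symm
  rw [hN] at h3
  field_simp at h3 ⊢
  linarith

lemma weightEnumerator_eq_zero_iff (h : FormallyDual S T) (y : ZMod N) :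
    weightEnumerator T y = 0 ↔ charSum S y = 0 := by
  have := h.normSq_charSum_mul_card y
  have hS := h.card_ne_zero_left
  have hT := h.card_ne_zero_right
  constructor <;> intro h0
  · simpa [h0, hT] using this
  · simpa [h0, hS] using this.symm

/-- If `S` is invariant under translation by `a ≠ 0`, then `charSum S` is supported on the
annihilator of `a`, which therefore contains all differences of elements of `T`. -/
lemma not_isPrimitiveSubset_of_periodic (h : FormallyDual S T) {a : ZMod N} (ha : a ≠ 0)
    (hper : ∀ x ∈ S, x + a ∈ S) : ¬ IsPrimitiveSubset T := by
  intro hT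
  obtain ⟨t₀, ht₀⟩ := h.2.1
  refine hT (AddMonoidHom.mulLeft a).ker ?_ t₀ fun t ht => ?_
  · intro htop
    have : (1 : ZMod N) ∈ (AddMonoidHom.mulLeft a).ker := htop ▸ AddSubgroup.mem_top _
    exact ha (by simpa using this)
  · have hpos : 0 < weightEnumerator T (t - t₀) :=
      weightEnumerator_pos_iff.2 ⟨t, ht, t₀, ht₀, rfl⟩
    have hne := (h.weightEnumerator_eq_zero_iff (t - t₀)).not.1 hpos.ne'
    have hS : S.image (· + a) = S := by
      apply eq_of_subset_of_card_le
      · intro x hx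
        obtain ⟨z, hz, rfl⟩ := mem_image.1 hx
        exact hper z hz
      · rw [card_image_of_injective _ (add_left_injective a)]
    have heq : charSum S (t - t₀) = charSum S (t - t₀) * ZMod.stdAddChar (a * (t - t₀)) := by
      conv_lhs => rw [charSum, ← hS, sum_image (add_left_injective a).injOn]
      rw [charSum, sum_mul]
      refine sum_congr rfl fun x _ => ?_
      rw [← AddChar.map_add_eq_mul, add_mul]
    have h1 : (ZMod.stdAddChar (a * (t - t₀)) : ℂ) = ZMod.stdAddChar (0 : ZMod N) := by
      rw [AddChar.map_zero_eq_one]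
      exact (mul_right_eq_self₀.1 heq.symm).resolve_right hne
    simpa using ZMod.injective_stdAddChar h1

end FormallyDual

end CharSum

/-! ### Periodic functions and Galois invariance -/

section Periodic

/-- The sum of a function on a finite group that is invariant under translation by `a` is divisible
by the order of `a`, because the function is constant on the cosets of `⟨a⟩`. -/
lemma addOrderOf_dvd_sum_of_periodic {G : Type*} [AddCommGroup G] [Fintype G] {f : G → ℕ} {a : G}
    (hf : ∀ x, f (x + a) = f x) : addOrderOf a ∣ ∑ x, f x := by
  classical
  have hn : ∀ n : ℕ, ∀ x, f (x + n • a) = f x := by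
    intro n
    induction n with
    | zero => simp
    | succ n ih => intro x; rw [succ_nsmul, ← add_assoc, hf, ih]
  have hK : ∀ k ∈ AddSubgroup.zmultiples a, ∀ x, f (x + k) = f x := by
    intro k hk x
    obtain ⟨n, rfl⟩ := (mem_zmultiples_iff_mem_range_addOrderOf.1 hk) |> mem_image.1 |>.imp
      fun _ h => h.2
    exact hn n x
  rw [← sum_fiberwise univ (QuotientAddGroup.mk : G → G ⧸ AddSubgroup.zmultiples a)]
  refine dvd_sum fun c _ => ?_
  obtain ⟨x₀, rfl⟩ := QuotientAddGroup.mk_surjective c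
  have hfib : (univ.filter fun x : G => (x : G ⧸ AddSubgroup.zmultiples a) = x₀) =
      (univ.filter (· ∈ AddSubgroup.zmultiples a)).image (x₀ + ·) := by
    ext x
    simp only [mem_filter, mem_univ, true_and, mem_image]
    rw [eq_comm, QuotientAddGroup.eq]
    exact ⟨fun h => ⟨_, h, by abel⟩, fun ⟨k, hk, e⟩ => by rw [← e]; simpa using hk⟩
  rw [hfib, sum_image (add_right_injective x₀).injOn,
    sum_congr rfl fun k hk => hK k (mem_filter.1 hk).2 x₀, sum_const, smul_eq_mul,
    ← Fintype.card_subtype, ← Nat.card_eq_fintype_card]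
  exact Dvd.intro _ (congrArg (· * f x₀) (Nat.card_zmultiples a).symm)

/-- A set that is invariant under translation by `a` is a union of cosets of `⟨a⟩`. -/
lemma addOrderOf_dvd_card_of_periodic {G : Type*} [AddCommGroup G] [Fintype G] [DecidableEq G]
    {P : Finset G} {a : G} (hP : ∀ x, x + a ∈ P ↔ x ∈ P) : addOrderOf a ∣ P.card := by
  have := addOrderOf_dvd_sum_of_periodic (f := fun x => if x ∈ P then 1 else 0) (a := a)
    (by simp [hP])
  simpa using this

end Periodic

section Galois
variable {N : ℕ} [NeZero N] {S T : Finset (ZMod N)}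

lemma isPrimitiveRoot_stdAddChar_one (N : ℕ) [NeZero N] :
    IsPrimitiveRoot (ZMod.stdAddChar (1 : ZMod N) : ℂ) N := by
  have := ZMod.stdAddChar_coe (N := N) 1
  rw [Int.cast_one] at this
  rw [this]
  simpa using Complex.isPrimitiveRoot_exp N (NeZero.ne N)

lemma stdAddChar_eq_pow_val (x : ZMod N) :
    (ZMod.stdAddChar x : ℂ) = ZMod.stdAddChar (1 : ZMod N) ^ x.val := by
  rw [← AddChar.map_nsmul_eq_pow, nsmul_one, ZMod.natCast_zmod_val]

/-- Galois invariance: the automorphisms of the `N`-th cyclotomic field fix rational numbers, and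
they act on the values of a character through multiplication of its argument by units. -/
lemma sum_sum_stdAddChar_unit_mul_eq (S : Finset (ZMod N)) (u : (ZMod N)ˣ) (y : ZMod N) (r : ℚ)
    (h : ∑ s ∈ S, ∑ t ∈ S, (ZMod.stdAddChar ((s - t) * y) : ℂ) = r) :
    ∑ s ∈ S, ∑ t ∈ S, (ZMod.stdAddChar ((s - t) * ((u : ZMod N) * y)) : ℂ) = r := by
  set ζ : ℂ := ZMod.stdAddChar (1 : ZMod N)
  have hζ : IsPrimitiveRoot ζ N := isPrimitiveRoot_stdAddChar_one N
  let P : Polynomial ℚ := ∑ s ∈ S, ∑ t ∈ S, Polynomial.X ^ ((s - t) * y).val - Polynomial.C r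
  have hP (z : ℂ) : Polynomial.aeval z P = ∑ s ∈ S, ∑ t ∈ S, z ^ ((s - t) * y).val - r := by
    simp [P]
  have h0 : Polynomial.aeval ζ P = 0 := by
    rw [hP, ← h, sub_eq_zero]
    exact sum_congr rfl fun s _ => sum_congr rfl fun t _ => (stdAddChar_eq_pow_val _).symm
  have hζu : IsPrimitiveRoot (ζ ^ (u : ZMod N).val) N :=
    hζ.pow_of_coprime _ (ZMod.val_coe_unit_coprime u)
  have hdvd := minpoly.dvd ℚ ζ h0
  rw [← Polynomial.cyclotomic_eq_minpoly_rat hζ (NeZero.pos N),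
    Polynomial.cyclotomic_eq_minpoly_rat hζu (NeZero.pos N)] at hdvd
  have h1 := (minpoly.dvd_iff).1 hdvd
  rw [hP, sub_eq_zero] at h1
  rw [← h1]
  refine sum_congr rfl fun s _ => sum_congr rfl fun t _ => ?_
  rw [← pow_mul, pow_mul', ← stdAddChar_eq_pow_val, ← AddChar.map_nsmul_eq_pow, nsmul_eq_mul,
    ZMod.natCast_zmod_val]
  congr 1; ring

namespace FormallyDual

lemma weightEnumerator_unit_mul (h : FormallyDual S T) (u : (ZMod N)ˣ) (y : ZMod N) :
    weightEnumerator T (u * y) = weightEnumerator T y := by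
  have hr (z : ZMod N) : ∑ s ∈ S, ∑ t ∈ S, (ZMod.stdAddChar ((s - t) * z) : ℂ) =
      ((S.card ^ 2 * weightEnumerator T z / T.card : ℚ) : ℂ) := by
    rw [← normSq_charSum, h.normSq_charSum_eq]
    push_cast; rfl
  have h1 := (hr (u * y)).symm.trans (sum_sum_stdAddChar_unit_mul_eq S u y _ (hr y))
  have hS : (S.card : ℚ) ≠ 0 := by exact_mod_cast h.1.card_pos.ne'
  have hT : (T.card : ℚ) ≠ 0 := by exact_mod_cast h.2.1.card_pos.ne'
  have h2 := (Rat.cast_injective (α := ℂ)) h1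
  field_simp at h2
  exact_mod_cast h2

/-- The rational number `|S|² ν_T(y) / |T|` is an algebraic integer. -/
lemma card_dvd_card_sq_mul_weightEnumerator (h : FormallyDual S T) (y : ZMod N) :
    T.card ∣ S.card ^ 2 * weightEnumerator T y := by
  have hint : IsIntegral ℤ (((S.card ^ 2 * weightEnumerator T y / T.card : ℚ)) : ℂ) := by
    have : (((S.card ^ 2 * weightEnumerator T y / T.card : ℚ)) : ℂ) =
        ∑ s ∈ S, ∑ t ∈ S, (ZMod.stdAddChar ((s - t) * y) : ℂ) := by
      rw [← normSq_charSum, h.normSq_charSum_eq]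
      push_cast; rfl
    rw [this]
    refine IsIntegral.sum _ fun s _ => IsIntegral.sum _ fun t _ => ?_
    rw [stdAddChar_eq_pow_val]
    exact ((isPrimitiveRoot_stdAddChar_one N).isIntegral (NeZero.pos N)).pow _
  have hint' : IsIntegral ℤ (S.card ^ 2 * weightEnumerator T y / T.card : ℚ) :=
    (isIntegral_algebraMap_iff (A := ℚ) (B := ℂ) Rat.cast_injective).1 hint
  obtain ⟨k, hk⟩ := IsIntegrallyClosed.isIntegral_iff.1 hint'
  have hT : (T.card : ℚ) ≠ 0 := by exact_mod_cast h.2.1.card_pos.ne'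
  rw [eq_div_iff hT, eq_intCast] at hk
  have : (T.card : ℤ) ∣ ((S.card ^ 2 * weightEnumerator T y : ℕ) : ℤ) :=
    ⟨k, by rw [mul_comm (T.card : ℤ)]; exact_mod_cast hk.symm⟩
  exact_mod_cast this

end FormallyDual

end Galois

/-! ### Vanishing of the Fourier transform at the units -/

section Vanishing

variable {N : ℕ} [NeZero N]

open scoped ZMod in
lemma dft_comp_add_right (f : ZMod N → ℂ) (c y : ZMod N) :
    𝓕 (fun x => f (x + c)) y = ZMod.stdAddChar (c * y) * 𝓕 f y := by
  simp only [ZMod.dft_apply, smul_eq_mul, mul_sum, ← mul_assoc, ← AddChar.map_add_eq_mul]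
  refine Fintype.sum_equiv (Equiv.addRight c) _ _ fun x => ?_
  rw [Equiv.coe_addRight]
  congr 2; ring

open scoped ZMod in
lemma dft_indicator (S : Finset (ZMod N)) (y : ZMod N) :
    𝓕 (fun x => if x ∈ S then (1 : ℂ) else 0) y = charSum S (-y) := by
  simp [ZMod.dft_apply, charSum]

open scoped ZMod in
/-- If the Fourier transform of `f` lives on the annihilator of `c`, then `f` is invariant under
translation by `c`. -/
lemma periodic_of_dft_eq_zero {f : ZMod N → ℂ} {c : ZMod N}
    (h : ∀ y, 𝓕 f y = 0 ∨ c * y = 0) (x : ZMod N) : f (x + c) = f x := by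
  have : (fun x => f (x + c)) = f := by
    apply ZMod.dft.injective
    ext y
    rw [dft_comp_add_right]
    rcases h y with h | h <;> simp [h]
  exact congrFun this x

open scoped ZMod in
/-- If every `y` in the support of the Fourier transform of `S` annihilates `c` or `d`, then the
product of the two difference operators with steps `c` and `d` kills the indicator function
of `S`. -/
lemma indicator_add_indicator_eq {S : Finset (ZMod N)} {c d : ZMod N}
    (h : ∀ y, charSum S y = 0 ∨ c * y = 0 ∨ d * y = 0) (x : ZMod N) :
    ((if x + c + d ∈ S then 1 else 0) + (if x ∈ S then 1 else 0) : ℂ) =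
      (if x + c ∈ S then 1 else 0) + if x + d ∈ S then 1 else 0 := by
  set g : ZMod N → ℂ := fun x => if x ∈ S then 1 else 0
  have hf : ∀ y, 𝓕 (fun x => g (x + c) - g x) y = (ZMod.stdAddChar (c * y) - 1) * 𝓕 g y := by
    intro y
    have : (fun x => g (x + c) - g x) = (fun x => g (x + c)) - g := rfl
    rw [this, map_sub, Pi.sub_apply, dft_comp_add_right]
    ring
  have := periodic_of_dft_eq_zero (f := fun x => g (x + c) - g x) (c := d) (fun y => by
    rw [hf, dft_indicator]
    rcases h (-y) with h | h | h
    · simp [h]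
    · left; rw [mul_neg, neg_eq_zero] at h; simp [h]
    · right; simpa using h) x
  change g (x + c + d) + g x = g (x + c) + g (x + d)
  simp only [add_right_comm x d c] at this
  linear_combination this

/-- If every `y` in the support of the Fourier transform of `S` annihilates `a` or `b`, then the
points of `S` outside the cosets of the ideal `(a)` contained in `S` form a set invariant under
translation by `b`. If `S` has `p q` elements, where `p` and `q` are the orders of `a` and `b`,
then one of the two parts of `S` is empty by divisibility. -/
lemma periodic_or_periodic_of_charSum {p q : ℕ} (hpq : p.Coprime q) {S : Finset (ZMod N)}
    (hcard : S.card = p * q) {a b : ZMod N} (ha : addOrderOf a = p) (hb : addOrderOf b = q)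
    (h : ∀ y, charSum S y = 0 ∨ a * y = 0 ∨ b * y = 0) :
    (∀ x ∈ S, x + a ∈ S) ∨ (∀ x ∈ S, x + b ∈ S) := by
  classical
  have hkey (k x : ZMod N) := indicator_add_indicator_eq (S := S) (c := k * a) (d := b)
    (fun y => (h y).imp_right (Or.imp_left fun h => by rw [mul_assoc, h, mul_zero])) x
  set P := S.filter fun x => ∀ k : ZMod N, x + k * a ∈ S with hP
  set Q := S.filter fun x => ¬ ∀ k : ZMod N, x + k * a ∈ S with hQ
  have hsum : P.card + Q.card = p * q := by rw [← hcard, hP, hQ, card_filter_add_card_filter_not]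
  have hPstep : ∀ j : ZMod N, ∀ x, x ∈ P → x + j * a ∈ P := by
    intro j x hx
    rw [hP, mem_filter] at hx ⊢
    refine ⟨hx.2 j, fun k => ?_⟩
    rw [add_assoc, ← add_mul]
    exact hx.2 _
  have hQstep : ∀ x, x ∈ Q → x + b ∈ Q := by
    intro x hx
    rw [hQ, mem_filter, not_forall] at hx ⊢
    obtain ⟨hxS, k, hk⟩ := hx
    have := hkey k x
    have hxb : x + b ∈ S ∧ x + k * a + b ∉ S := by
      rw [if_pos hxS, if_neg hk] at this
      by_cases h1 : x + b ∈ S <;> by_cases h2 : x + k * a + b ∈ S <;> simp [h1, h2] at this ⊢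
    exact ⟨hxb.1, k, by rw [add_right_comm]; exact hxb.2⟩
  have hpP : p ∣ P.card := by
    rw [← ha]
    refine addOrderOf_dvd_card_of_periodic fun x => ⟨fun hx => ?_, fun hx => ?_⟩
    · simpa using hPstep (-1) _ hx
    · simpa using hPstep 1 _ hx
  have hqQ : q ∣ Q.card := by
    rw [← hb]
    have him : Q.image (· + b) = Q := by
      apply eq_of_subset_of_card_le
      · intro x hx
        obtain ⟨z, hz, rfl⟩ := mem_image.1 hx
        exact hQstep z hz
      · rw [card_image_of_injective _ (add_left_injective b)]
    refine addOrderOf_dvd_card_of_periodic fun x => ⟨fun hx => ?_, hQstep x⟩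
    rw [← him] at hx
    obtain ⟨z, hz, e⟩ := mem_image.1 hx
    rwa [← add_right_cancel e]
  have hqP : q ∣ P.card := (Nat.dvd_add_left hqQ).1 (hsum ▸ dvd_mul_left q p)
  obtain ⟨m, hm⟩ := hpq.mul_dvd_of_dvd_of_dvd hpP hqP
  have hSpos : p * q = 0 ∨ 0 < p * q := Nat.eq_zero_or_pos _
  rcases hSpos with h0 | hpos
  · rw [h0, card_eq_zero] at hcard
    simp [hcard]
  rcases m with _ | m
  · -- no coset of `(a)` lies in `S`
    right
    intro x hx
    have hPe : P = ∅ := by rw [← card_eq_zero, hm, mul_zero]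
    have hxQ : x ∈ Q := by
      rw [hQ, mem_filter]
      refine ⟨hx, fun hall => ?_⟩
      have : x ∈ P := by rw [hP, mem_filter]; exact ⟨hx, hall⟩
      simp [hPe] at this
    exact (mem_filter.1 (hQstep x hxQ)).1
  · left
    intro x hx
    have hle : p * q ≤ P.card := by rw [hm]; exact Nat.le_mul_of_pos_right _ m.succ_pos
    have hPS : P.card = S.card := by omega
    have := (card_filter_eq_iff.1 hPS) x hx 1
    simpa using this

end Vanishing

section Arithmetic

variable {N p q : ℕ}

lemma isUnit_or_dvd_of_eq_sq_mul_sq (hp : p.Prime) (hq : q.Prime) (hN : N = p ^ 2 * q ^ 2)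
    (y : ZMod N) : IsUnit y ∨ (p : ZMod N) ∣ y ∨ (q : ZMod N) ∣ y := by
  have : NeZero N := ⟨by rw [hN]; have := hp.pos; have := hq.pos; positivity⟩
  by_cases h : y.val.Coprime N
  · left
    rw [← ZMod.natCast_zmod_val y, ZMod.isUnit_iff_coprime]
    exact h
  · right
    obtain ⟨r, hr, hry, hrN⟩ := Nat.Prime.not_coprime_iff_dvd.1 h
    have hry' : (r : ZMod N) ∣ y := by
      rw [← ZMod.natCast_zmod_val y]; exact Nat.cast_dvd_cast hry
    rw [hN, hr.dvd_mul] at hrN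
    rcases hrN with h | h
    · exact Or.inl ((Nat.prime_dvd_prime_iff_eq hr hp).1 (hr.dvd_of_dvd_pow h) ▸ hry')
    · exact Or.inr ((Nat.prime_dvd_prime_iff_eq hr hq).1 (hr.dvd_of_dvd_pow h) ▸ hry')

lemma addOrderOf_natCast_mul_sq (hp : p.Prime) (hq : q.Prime) (hN : N = p ^ 2 * q ^ 2) :
    addOrderOf ((p * q ^ 2 : ℕ) : ZMod N) = p := by
  have := hp.pos
  have := hq.pos
  have h0 : N ≠ 0 := by rw [hN]; positivity
  rw [ZMod.addOrderOf_coe _ h0, hN, show p ^ 2 * q ^ 2 = (p * q ^ 2) * p by ring,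
    Nat.gcd_mul_right_left, Nat.mul_div_cancel_left _ (by positivity)]

end Arithmetic

namespace FormallyDual

variable {N : ℕ} [NeZero N] {S T : Finset (ZMod N)} {p q : ℕ}

lemma charSum_unit_mul_eq_zero (h : FormallyDual S T) {y : ZMod N} (u : (ZMod N)ˣ)
    (h0 : charSum S y = 0) : charSum S (u * y) = 0 := by
  rw [← h.weightEnumerator_eq_zero_iff, h.weightEnumerator_unit_mul,
    h.weightEnumerator_eq_zero_iff, h0]

/-- All units are differences of `T`. Otherwise the Fourier transform of `S` vanishes at all units,
so that its support annihilates an element of order `p` or one of order `q`, and `S` is periodic. -/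
lemma weightEnumerator_unit_pos (h : FormallyDual S T) (hT : IsPrimitiveSubset T) (hp : p.Prime)
    (hq : q.Prime) (hpq : p ≠ q) (hN : N = p ^ 2 * q ^ 2) (hS : S.card = p * q) (u : (ZMod N)ˣ) :
    0 < weightEnumerator T u := by
  by_contra! hu
  have h1 : charSum S u = 0 := by
    rw [← h.weightEnumerator_eq_zero_iff]; omega
  have hNp : ((p ^ 2 * q ^ 2 : ℕ) : ZMod N) = 0 := by rw [← hN]; simp
  have ha := addOrderOf_natCast_mul_sq hp hq hN
  have hb := addOrderOf_natCast_mul_sq hq hp (hN.trans (mul_comm _ _))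
  have hne (c : ZMod N) {r : ℕ} (hr : r.Prime) (hc : addOrderOf c = r) : c ≠ 0 := by
    rintro rfl
    rw [addOrderOf_zero] at hc
    exact hr.one_lt.ne hc
  have hvan : ∀ y, charSum S y = 0 ∨ ((p * q ^ 2 : ℕ) : ZMod N) * y = 0 ∨
      ((q * p ^ 2 : ℕ) : ZMod N) * y = 0 := by
    intro y
    push_cast at hNp ⊢
    rcases isUnit_or_dvd_of_eq_sq_mul_sq hp hq hN y with ⟨v, rfl⟩ | ⟨z, rfl⟩ | ⟨z, rfl⟩
    · left
      have := h.charSum_unit_mul_eq_zero (v * u⁻¹) h1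
      simpa using this
    · right; left
      linear_combination z * hNp
    · right; right
      linear_combination z * hNp
  rcases periodic_or_periodic_of_charSum ((Nat.coprime_primes hp hq).2 hpq) hS ha hb hvan with
    hper | hper
  · exact h.not_isPrimitiveSubset_of_periodic (hne _ hp ha) hper hT
  · exact h.not_isPrimitiveSubset_of_periodic (hne _ hq hb) hper hT

end FormallyDual

/-! ### Differences modulo a divisor of `N` -/

/-- The number of pairs `(s, t) ∈ S × S` with `s - t ≡ j` modulo a divisor `m` of `N`: the
difference function of the image of `S` in `ZMod m`, taken with multiplicities. -/
def foldedEnumerator {N m : ℕ} [NeZero N] (hm : m ∣ N) (S : Finset (ZMod N)) (j : ZMod m) : ℕ :=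
  ∑ x with ZMod.castHom hm (ZMod m) x = j, weightEnumerator S x

section Folded

variable {N m : ℕ} [NeZero N] {hm : m ∣ N} {S : Finset (ZMod N)}

lemma foldedEnumerator_unit_mul
    (hS : ∀ (u : (ZMod N)ˣ) y, weightEnumerator S (u * y) = weightEnumerator S y)
    (u : (ZMod m)ˣ) (j : ZMod m) : foldedEnumerator hm S (u * j) = foldedEnumerator hm S j := by
  obtain ⟨v, rfl⟩ := ZMod.unitsMap_surjective hm u
  symm
  refine sum_bij (fun x _ => (v : ZMod N) * x) ?_ ?_ ?_ ?_
  · intro x hx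
    rw [mem_filter] at hx ⊢
    refine ⟨mem_univ _, ?_⟩
    rw [map_mul, hx.2]
    rfl
  · intro x _ y _ h
    exact v.isUnit.mul_left_cancel h
  · intro x hx
    rw [mem_filter] at hx
    refine ⟨(v⁻¹ : (ZMod N)ˣ) * x, ?_, by simp⟩
    rw [mem_filter]
    refine ⟨mem_univ _, ?_⟩
    have : ((ZMod.unitsMap hm v : (ZMod m)ˣ) : ZMod m) = ZMod.castHom hm (ZMod m) v := rfl
    apply (ZMod.unitsMap hm v).isUnit.mul_left_cancel
    rw [← hx.2, this, ← map_mul]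
    simp
  · intro x _
    exact (hS v x).symm

variable [NeZero m]

lemma sum_sum_castHom_sub_eq (hm : m ∣ N) (S : Finset (ZMod N)) {M : Type*} [AddCommMonoid M]
    (F : ZMod m → M) :
    ∑ s ∈ S, ∑ t ∈ S, F (ZMod.castHom hm (ZMod m) s - ZMod.castHom hm (ZMod m) t) =
      ∑ j, foldedEnumerator hm S j • F j := by
  simp_rw [← map_sub]
  rw [sum_sum_sub_eq_sum_weightEnumerator S (fun x => F (ZMod.castHom hm (ZMod m) x)),
    ← sum_fiberwise univ (ZMod.castHom hm (ZMod m))]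
  refine sum_congr rfl fun j _ => ?_
  rw [foldedEnumerator, sum_smul]
  exact sum_congr rfl fun x hx => by rw [(mem_filter.1 hx).2]

lemma sum_foldedEnumerator (hm : m ∣ N) (S : Finset (ZMod N)) :
    ∑ j, foldedEnumerator hm S j = S.card ^ 2 := by
  simpa [sq] using (sum_sum_castHom_sub_eq hm S (fun _ => (1 : ℕ))).symm

lemma sum_filter_isUnit {R M : Type*} [CommMonoid R] [Fintype R] [DecidableEq R]
    [DecidablePred (IsUnit : R → Prop)] [AddCommMonoid M] (f : R → M) :
    ∑ j with IsUnit j, f j = ∑ u : Rˣ, f u := by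
  symm
  refine sum_bij (fun u _ => (u : R)) ?_ ?_ ?_ ?_
  · intro u _; simp
  · intro u _ v _ h; exact Units.ext h
  · intro j hj
    obtain ⟨u, rfl⟩ := (mem_filter.1 hj).2
    exact ⟨u, mem_univ _, rfl⟩
  · intro u _; rfl

lemma sum_isUnit_foldedEnumerator [DecidablePred (IsUnit : ZMod m → Prop)]
    (hS : ∀ (u : (ZMod N)ˣ) y, weightEnumerator S (u * y) = weightEnumerator S y) :
    ∑ j with IsUnit j, foldedEnumerator hm S j = m.totient * foldedEnumerator hm S 1 := by
  rw [sum_filter_isUnit]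
  have (u : (ZMod m)ˣ) : foldedEnumerator hm S u = foldedEnumerator hm S 1 := by
    simpa using foldedEnumerator_unit_mul (hm := hm) hS u 1
  simp_rw [this]
  simp

/-- The standard character modulo `m` is a power of the one modulo `N = M m`. -/
lemma stdAddChar_castHom {M : ℕ} (hN : N = M * m) (hm : m ∣ N) (x : ZMod N) :
    (ZMod.stdAddChar (ZMod.castHom hm (ZMod m) x) : ℂ) = ZMod.stdAddChar ((M : ZMod N) * x) := by
  obtain ⟨k, rfl⟩ := ZMod.intCast_surjective x
  have h1 : ((M : ZMod N) * (k : ZMod N)) = ((M * k : ℤ) : ZMod N) := by push_cast; rfl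
  have hM : (M : ℂ) ≠ 0 := by
    have := NeZero.ne N
    rintro h
    rw [Nat.cast_eq_zero] at h
    simp [hN, h] at this
  have hm0 : (m : ℂ) ≠ 0 := Nat.cast_ne_zero.2 (NeZero.ne m)
  rw [h1, map_intCast, ZMod.stdAddChar_coe, ZMod.stdAddChar_coe]
  congr 1
  have : (N : ℂ) = M * m := by rw [hN]; push_cast; rfl
  rw [this]
  push_cast
  field_simp

lemma charSum_natCast_mul {M : ℕ} (hN : N = M * m) (hm : m ∣ N) (S : Finset (ZMod N))
    (x : ZMod N) :
    charSum S (M * x) = ∑ s ∈ S, (ZMod.stdAddChar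
      (ZMod.castHom hm (ZMod m) s * ZMod.castHom hm (ZMod m) x) : ℂ) := by
  refine sum_congr rfl fun s _ => ?_
  rw [← map_mul, stdAddChar_castHom hN]
  congr 1; ring

/-- Poisson summation for the subgroup of `ZMod N` of order `m`. -/
lemma sum_normSq_charSum_natCast_mul {M : ℕ} (hN : N = M * m) (hm : m ∣ N) (S : Finset (ZMod N)) :
    ∑ k : ZMod m, ‖charSum S (M * (k.val : ZMod N))‖ ^ 2 = m * foldedEnumerator hm S 0 := by
  have h1 (k : ZMod m) : ((‖charSum S (M * (k.val : ZMod N))‖ ^ 2 : ℝ) : ℂ) =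
      ∑ j : ZMod m, foldedEnumerator hm S j • (ZMod.stdAddChar (j * k) : ℂ) := by
    rw [← sum_sum_castHom_sub_eq hm S (fun j => (ZMod.stdAddChar (j * k) : ℂ)), normSq_charSum]
    refine sum_congr rfl fun s _ => sum_congr rfl fun t _ => ?_
    have hk : (ZMod.castHom hm (ZMod m) s - ZMod.castHom hm (ZMod m) t) * k =
        ZMod.castHom hm (ZMod m) ((s - t) * (k.val : ZMod N)) := by
      rw [map_mul, map_sub, map_natCast, ZMod.natCast_zmod_val]
    rw [hk, stdAddChar_castHom hN]
    congr 1; ring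
  apply Complex.ofReal_injective
  rw [Complex.ofReal_sum]
  simp_rw [h1]
  rw [sum_comm]
  simp_rw [← smul_sum, sum_stdAddChar_mul]
  simp [mul_comm]

end Folded

section PrimeSquare

variable {q : ℕ}

lemma ZMod.isUnit_iff_not_dvd_of_sq (hq : q.Prime) (j : ZMod (q ^ 2)) :
    IsUnit j ↔ ¬ (q : ZMod (q ^ 2)) ∣ j := by
  have : NeZero (q ^ 2) := ⟨by have := hq.pos; positivity⟩
  constructor
  · rintro hj hd
    have hqu : IsUnit (q : ZMod (q ^ 2)) := isUnit_of_dvd_unit hd hj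
    rw [ZMod.isUnit_iff_coprime, Nat.coprime_pow_right_iff two_pos, Nat.coprime_self] at hqu
    exact hq.one_lt.ne' hqu
  · intro hj
    rw [← ZMod.natCast_zmod_val j, ZMod.isUnit_iff_coprime, Nat.coprime_pow_right_iff two_pos,
      Nat.coprime_comm, hq.coprime_iff_not_dvd]
    intro hd
    exact hj (by rw [← ZMod.natCast_zmod_val j]; exact Nat.cast_dvd_cast hd)

lemma ZMod.castHom_eq_zero_iff_dvd {N m : ℕ} [NeZero N] (hm : m ∣ N) (x : ZMod N) :
    ZMod.castHom hm (ZMod m) x = 0 ↔ (m : ZMod N) ∣ x := by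
  constructor
  · intro h
    rw [← ZMod.natCast_zmod_val x, map_natCast, ZMod.natCast_eq_zero_iff] at h
    rw [← ZMod.natCast_zmod_val x]
    exact Nat.cast_dvd_cast h
  · rintro ⟨y, rfl⟩
    rw [map_mul, map_natCast, ZMod.natCast_self, zero_mul]

lemma foldedEnumerator_of_dvd {N m l : ℕ} [NeZero N] [NeZero m] [NeZero l] (hm : m ∣ N)
    (hl : l ∣ m) (S : Finset (ZMod N)) :
    foldedEnumerator (hl.trans hm) S 0 =
      ∑ j with ZMod.castHom hl (ZMod l) j = 0, foldedEnumerator hm S j := by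
  rw [foldedEnumerator, ← sum_fiberwise _ (ZMod.castHom hm (ZMod m)), sum_filter]
  refine sum_congr rfl fun j _ => ?_
  have hcomp (x : ZMod N) : ZMod.castHom (hl.trans hm) (ZMod l) x =
      ZMod.castHom hl (ZMod l) (ZMod.castHom hm (ZMod m) x) :=
    (RingHom.congr_fun (Subsingleton.elim _ ((ZMod.castHom hl (ZMod l)).comp
      (ZMod.castHom hm (ZMod m)))) x)
  split_ifs with h
  · rw [foldedEnumerator, filter_filter]
    refine sum_congr (filter_congr fun x _ => ?_) fun _ _ => rfl
    rw [hcomp]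
    exact ⟨fun hx => hx.2, fun hx => ⟨by rw [hx, h], hx⟩⟩
  · rw [filter_filter]
    refine sum_eq_zero fun x hx => ?_
    obtain ⟨-, h1, h2⟩ := mem_filter.1 hx
    rw [hcomp, h2] at h1
    exact absurd h1 h

/-- The pairs of elements of `S`, sorted by whether their difference is prime to `q`. -/
lemma card_sq_eq_foldedEnumerator {N : ℕ} [NeZero N] {S : Finset (ZMod N)} (hq : q.Prime)
    (hm : q ^ 2 ∣ N) (hm' : q ∣ N)
    (hS : ∀ (u : (ZMod N)ˣ) y, weightEnumerator S (u * y) = weightEnumerator S y) :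
    S.card ^ 2 = q * (q - 1) * foldedEnumerator hm S 1 + foldedEnumerator hm' S 0 := by
  classical
  have : NeZero (q ^ 2) := ⟨by have := hq.pos; positivity⟩
  have : NeZero q := ⟨hq.ne_zero⟩
  have hl : q ∣ q ^ 2 := dvd_pow_self q two_ne_zero
  have htot : (q ^ 2).totient = q * (q - 1) := by
    rw [Nat.totient_prime_pow hq two_pos]; simp
  rw [← sum_foldedEnumerator hm S, ← sum_filter_add_sum_filter_not univ IsUnit,
    sum_isUnit_foldedEnumerator hS, htot, foldedEnumerator_of_dvd hm hl S]
  congr 2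
  ext j
  rw [mem_filter, mem_filter, ZMod.isUnit_iff_not_dvd_of_sq hq, not_not,
    ZMod.castHom_eq_zero_iff_dvd]

end PrimeSquare

/-! ### The cardinalities of a primitive formally dual pair -/

section Cardinality

variable {N : ℕ} {S T : Finset (ZMod N)} {p q : ℕ}

lemma not_isPrimitiveSubset_of_sub_mul_eq_zero {c : ZMod N} (hc : c ≠ 0) (hne : S.Nonempty)
    (h : ∀ s ∈ S, ∀ t ∈ S, c * (s - t) = 0) : ¬ IsPrimitiveSubset S := by
  intro hS
  obtain ⟨t, ht⟩ := hne
  refine hS (AddMonoidHom.mulLeft c).ker (fun htop => ?_) t fun s hs => by simpa using h s hs t ht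
  have : (1 : ZMod N) ∈ (AddMonoidHom.mulLeft c).ker := htop ▸ AddSubgroup.mem_top _
  exact hc (by simpa using this)

variable [NeZero N]

/-- A primitive set with unit-invariant difference function cannot have only `q` elements. There are
`q (q - 1)` pairs of distinct elements and as many residues modulo `q²` prime to `q`, all equally
frequent among the differences. If none of them occurs, all differences are divisible by `q`.
Otherwise each occurs exactly once, and invariance under multiplication by `1 + p q²` makes all
differences divisible by `p`. -/
lemma not_isPrimitiveSubset_of_card_eq_prime (hp : p.Prime) (hq : q.Prime) (hpq : p ≠ q)
    (hN : N = p ^ 2 * q ^ 2)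
    (hinv : ∀ (u : (ZMod N)ˣ) y, weightEnumerator S (u * y) = weightEnumerator S y)
    (hcard : S.card = q) : ¬ IsPrimitiveSubset S := by
  classical
  intro hS
  have hm : q ^ 2 ∣ N := hN ▸ dvd_mul_left _ _
  have hm' : q ∣ N := (dvd_pow_self q two_ne_zero).trans hm
  have : NeZero (q ^ 2) := ⟨by have := hq.pos; positivity⟩
  have : NeZero q := ⟨hq.ne_zero⟩
  have hne : S.Nonempty := card_pos.1 (hcard ▸ hq.pos)
  have hsq := card_sq_eq_foldedEnumerator hq hm hm' hinv
  have h0 : (0 : ZMod N) ∈ univ.filter fun x => ZMod.castHom hm' (ZMod q) x = 0 :=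
    mem_filter.2 ⟨mem_univ _, map_zero _⟩
  have hE : foldedEnumerator hm' S 0 = q +
      ∑ x ∈ (univ.filter fun x => ZMod.castHom hm' (ZMod q) x = 0).erase 0,
        weightEnumerator S x := by
    rw [foldedEnumerator, ← add_sum_erase _ _ h0, weightEnumerator_zero, hcard]
  obtain ⟨r, hr⟩ : ∃ r, q = r + 2 := ⟨q - 2, by have := hq.two_le; omega⟩
  set R := ∑ x ∈ (univ.filter fun x => ZMod.castHom hm' (ZMod q) x = 0).erase 0,
        weightEnumerator S x with hR
  set A := foldedEnumerator hm S 1 with hA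
  have hq1 : q - 1 = r + 1 := by omega
  rw [hcard, hE, hq1] at hsq
  have hpos : 0 < q * (r + 1) := Nat.mul_pos hq.pos r.succ_pos
  have hsq' : q * (r + 1) * A + R = q * (r + 1) := by
    have : q ^ 2 = q * (r + 1) + q := by nlinarith
    omega
  have hA1 : A ≤ 1 := by
    by_contra! h
    have := Nat.mul_le_mul_left (q * (r + 1)) h
    omega
  have hqdvd (x : ZMod N) : ¬ IsUnit (ZMod.castHom hm (ZMod (q ^ 2)) x) →
      ZMod.castHom hm' (ZMod q) x = 0 := by
    rw [ZMod.isUnit_iff_not_dvd_of_sq hq, not_not]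
    intro h
    rw [show ZMod.castHom hm' (ZMod q) = (ZMod.castHom (dvd_pow_self q two_ne_zero)
      (ZMod q)).comp (ZMod.castHom hm (ZMod (q ^ 2))) from Subsingleton.elim _ _,
      RingHom.comp_apply, ZMod.castHom_eq_zero_iff_dvd]
    exact h
  have hle (u : (ZMod (q ^ 2))ˣ) : foldedEnumerator hm S u = A := by
    simpa using foldedEnumerator_unit_mul (hm := hm) hinv u 1
  have hcop : p.Coprime q := (Nat.coprime_primes hp hq).2 hpq
  have hcast (a : ℕ) (ha : ((a : ℕ) : ZMod N) = 0) : p ^ 2 * q ^ 2 ∣ a := by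
    rwa [ZMod.natCast_eq_zero_iff, hN] at ha
  rcases Nat.le_one_iff_eq_zero_or_eq_one.1 hA1 with hA0 | hA1
  · -- all differences are divisible by `q`
    refine not_isPrimitiveSubset_of_sub_mul_eq_zero (c := ((p ^ 2 * q : ℕ) : ZMod N)) ?_ hne ?_ hS
    · intro h
      have h1 := Nat.le_of_dvd (Nat.mul_pos (pow_pos hp.pos 2) hq.pos) (hcast _ h)
      have h2 := Nat.le_of_mul_le_mul_left h1 (pow_pos hp.pos 2)
      nlinarith
    · intro s hs t ht
      have hpos : 0 < weightEnumerator S (s - t) :=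
        weightEnumerator_pos_iff.2 ⟨s, hs, t, ht, rfl⟩
      by_cases hu : IsUnit (ZMod.castHom hm (ZMod (q ^ 2)) (s - t))
      · obtain ⟨u, hu⟩ := hu
        have := hle u
        rw [hA0, foldedEnumerator, sum_eq_zero_iff] at this
        exact absurd (this (s - t) (by rw [mem_filter]; exact ⟨mem_univ _, hu.symm⟩)) hpos.ne'
      · obtain ⟨z, hz⟩ := (ZMod.castHom_eq_zero_iff_dvd hm' _).1 (hqdvd _ hu)
        have hNp : ((p ^ 2 * q ^ 2 : ℕ) : ZMod N) = 0 := by rw [← hN]; simp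
        push_cast at hNp ⊢
        rw [hz]
        linear_combination z * hNp
  · -- `1 + p q²` fixes every residue modulo `q²`, hence every difference
    have hR0 : R = 0 := by rw [hA1, mul_one] at hsq'; omega
    have hucop : (1 + p * q ^ 2).Coprime N := by
      rw [hN]
      refine Nat.Coprime.mul_right (Nat.Coprime.pow_right _ ?_) (Nat.Coprime.pow_right _ ?_)
      · simp
      · rw [show p * q ^ 2 = (p * q) * q by ring]; simp
    let w := ZMod.unitOfCoprime _ hucop
    refine not_isPrimitiveSubset_of_sub_mul_eq_zero (c := ((p * q ^ 2 : ℕ) : ZMod N)) ?_ hne ?_ hS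
    · intro h
      have h1 := Nat.le_of_dvd (Nat.mul_pos hp.pos (pow_pos hq.pos 2)) (hcast _ h)
      have h2 := Nat.le_of_mul_le_mul_right h1 (pow_pos hq.pos 2)
      have := hp.two_le
      nlinarith
    · intro s hs t ht
      have hpos : 0 < weightEnumerator S (s - t) :=
        weightEnumerator_pos_iff.2 ⟨s, hs, t, ht, rfl⟩
      set x := s - t
      by_cases hu : IsUnit (ZMod.castHom hm (ZMod (q ^ 2)) x)
      · obtain ⟨u, hu⟩ := hu
        by_contra hx
        have hwx : (w : ZMod N) * x = x + ((p * q ^ 2 : ℕ) : ZMod N) * x := by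
          rw [show (w : ZMod N) = ((1 + p * q ^ 2 : ℕ) : ZMod N) from ZMod.coe_unitOfCoprime _ _]
          push_cast; ring
        have hpair : ({x, (w : ZMod N) * x} : Finset (ZMod N)) ⊆
            univ.filter fun y => ZMod.castHom hm (ZMod (q ^ 2)) y = u := by
          intro y hy
          rw [mem_filter]
          refine ⟨mem_univ _, ?_⟩
          rcases mem_insert.1 hy with rfl | hy
          · exact hu.symm
          · rw [mem_singleton.1 hy, hwx, map_add, map_mul, map_natCast, ← hu]
            have : ((q ^ 2 : ℕ) : ZMod (q ^ 2)) = 0 := ZMod.natCast_self _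
            rw [Nat.cast_mul, this]; ring
        have h2 := sum_le_sum_of_subset (f := weightEnumerator S) hpair
        rw [sum_pair (by rw [hwx]; simpa using hx), hinv] at h2
        have := hle u
        rw [foldedEnumerator] at this
        omega
      · by_cases hx : x = 0
        · rw [hx, mul_zero]
        · rw [hR, sum_eq_zero_iff] at hR0
          exact absurd (hR0 x (mem_erase.2 ⟨hx, mem_filter.2 ⟨mem_univ _, hqdvd x hu⟩⟩)) hpos.ne'

lemma not_isPrimitiveSubset_of_card_eq_one (hN : N ≠ 1) (hcard : S.card = 1) :
    ¬ IsPrimitiveSubset S := by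
  obtain ⟨s, rfl⟩ := card_eq_one.1 hcard
  have : Fact (1 < N) := ⟨by have := NeZero.ne N; omega⟩
  refine not_isPrimitiveSubset_of_sub_mul_eq_zero (c := 1) one_ne_zero (singleton_nonempty s) ?_
  intro a ha b hb
  rw [mem_singleton.1 ha, mem_singleton.1 hb, sub_self, mul_zero]

/-- By integrality, if `|T|` is prime to `|S|` then all values of the difference function of `T` are
multiples of `|T|`, so that `T` is a coset of a subgroup. -/
lemma FormallyDual.not_isPrimitiveSubset_of_coprime (h : FormallyDual S T)
    (hcop : T.card.Coprime S.card) (hT : T.card ≠ 1) : ¬ IsPrimitiveSubset S := by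
  have h1 : 1 < T.card := by have := h.2.1.card_pos; omega
  obtain ⟨a, ha, b, hb, hab⟩ := one_lt_card.1 h1
  have hd := (hcop.pow_right 2).dvd_of_dvd_mul_left
    (h.card_dvd_card_sq_mul_weightEnumerator (a - b))
  have hpos : 0 < weightEnumerator T (a - b) :=
    weightEnumerator_pos_iff.2 ⟨a, ha, b, hb, rfl⟩
  have heq := le_antisymm (weightEnumerator_le_card T (a - b)) (Nat.le_of_dvd hpos hd)
  exact h.symm.not_isPrimitiveSubset_of_periodic (sub_ne_zero.2 hab)
    fun x hx => add_mem_of_weightEnumerator_eq_card heq hx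

/-- The two sets of a primitive formally dual pair have `p q` elements each. -/
lemma FormallyDual.card_eq_mul (h : FormallyDual S T) (hS : IsPrimitiveSubset S)
    (hT : IsPrimitiveSubset T) (hp : p.Prime) (hq : q.Prime) (hpq : p ≠ q)
    (hN : N = p ^ 2 * q ^ 2) : S.card = p * q ∧ T.card = p * q := by
  have hN' : N = q ^ 2 * p ^ 2 := hN.trans (mul_comm _ _)
  have hN1 : N ≠ 1 := by
    rw [hN, Ne, mul_eq_one, Nat.pow_eq_one]
    have := hp.one_lt
    omega
  have hprod : S.card * T.card = p ^ 2 * q ^ 2 := h.card_mul_card.trans hN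
  have hp0 := hp.pos
  have hq0 := hq.pos
  have hcop : p.Coprime q := (Nat.coprime_primes hp hq).2 hpq
  have hSp := fun hc => not_isPrimitiveSubset_of_card_eq_prime hq hp hpq.symm hN'
    h.symm.weightEnumerator_unit_mul hc hS
  have hSq := fun hc => not_isPrimitiveSubset_of_card_eq_prime hp hq hpq hN
    h.symm.weightEnumerator_unit_mul hc hS
  have hTp := fun hc => not_isPrimitiveSubset_of_card_eq_prime hq hp hpq.symm hN'
    h.weightEnumerator_unit_mul hc hT
  have hTq := fun hc => not_isPrimitiveSubset_of_card_eq_prime hp hq hpq hN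
    h.weightEnumerator_unit_mul hc hT
  have hS1 := fun hc => not_isPrimitiveSubset_of_card_eq_one hN1 hc hS
  have hT1 := fun hc => not_isPrimitiveSubset_of_card_eq_one hN1 hc hT
  have hST := fun hc => h.not_isPrimitiveSubset_of_coprime hc hT1 hS
  obtain ⟨k₁, k₂, hk₁, hk₂, hk⟩ := exists_dvd_and_dvd_of_dvd_mul (Dvd.intro _ hprod)
  obtain ⟨i, hi, rfl⟩ := (Nat.dvd_prime_pow hp).1 hk₁
  obtain ⟨j, hj, rfl⟩ := (Nat.dvd_prime_pow hq).1 hk₂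
  have hTeq : T.card = p ^ (2 - i) * q ^ (2 - j) := by
    rw [hk] at hprod
    refine Nat.eq_of_mul_eq_mul_left (Nat.mul_pos (pow_pos hp0 i) (pow_pos hq0 j)) ?_
    rw [hprod, mul_mul_mul_comm, ← pow_add, ← pow_add]
    rw [Nat.add_sub_cancel' hi, Nat.add_sub_cancel' hj]
  interval_cases i <;> interval_cases j <;>
    simp only [pow_zero, pow_one, one_mul, mul_one, tsub_zero, tsub_self,
      Nat.add_one_sub_one] at hk hTeq
  · exact absurd hk hS1
  · exact absurd hk hSq
  · exact absurd (by rw [hk, hTeq]; exact hcop.pow 2 2) hST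
  · exact absurd hk hSp
  · exact ⟨hk, hTeq⟩
  · exact absurd hTeq hTp
  · exact absurd (by rw [hk, hTeq]; exact (hcop.pow 2 2).symm) hST
  · exact absurd hTeq hTq
  · exact absurd hTeq hT1

end Cardinality

/-! ### Power sums modulo `q²` -/

section PowerSum

variable {q : ℕ}

lemma ZMod.mul_eq_zero_of_dvd_of_dvd {a b : ZMod (q ^ 2)} (ha : (q : ZMod (q ^ 2)) ∣ a)
    (hb : (q : ZMod (q ^ 2)) ∣ b) : a * b = 0 := by
  obtain ⟨a, rfl⟩ := ha
  obtain ⟨b, rfl⟩ := hb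
  have : ((q ^ 2 : ℕ) : ZMod (q ^ 2)) = 0 := ZMod.natCast_self _
  push_cast at this
  linear_combination a * b * this

lemma ZMod.dvd_unit_pow_sub_one (hq : q.Prime) (u : (ZMod (q ^ 2))ˣ) :
    (q : ZMod (q ^ 2)) ∣ (u : ZMod (q ^ 2)) ^ (q - 1) - 1 := by
  have : NeZero (q ^ 2) := ⟨by have := hq.pos; positivity⟩
  have : Fact q.Prime := ⟨hq⟩
  rw [← ZMod.castHom_eq_zero_iff_dvd (dvd_pow_self q two_ne_zero), map_sub, map_pow, map_one,
    ZMod.pow_card_sub_one_eq_one, sub_self]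
  exact (u.isUnit.map _).ne_zero

/-- Pairing each unit `u` with `u⁻¹` and using `(1 + q c) + (1 + q c)⁻¹ = 2` modulo `q²`. -/
lemma ZMod.sum_units_pow_sub_one (hq : q.Prime) (hq2 : q ≠ 2) [NeZero (q ^ 2)] :
    ∑ u : (ZMod (q ^ 2))ˣ, (u : ZMod (q ^ 2)) ^ (q - 1) = -(q : ZMod (q ^ 2)) := by
  have h2 : IsUnit (2 : ZMod (q ^ 2)) := by
    have := (ZMod.isUnit_iff_coprime 2 (q ^ 2)).2
      (((Nat.coprime_primes Nat.prime_two hq).2 (Ne.symm hq2)).pow_right 2)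
    simpa using this
  have hqq : ((q ^ 2 : ℕ) : ZMod (q ^ 2)) = 0 := ZMod.natCast_self _
  push_cast at hqq
  have hpair (u : (ZMod (q ^ 2))ˣ) :
      (u : ZMod (q ^ 2)) ^ (q - 1) + ((u⁻¹ : (ZMod (q ^ 2))ˣ) : ZMod (q ^ 2)) ^ (q - 1) = 2 := by
    have h1 := ZMod.mul_eq_zero_of_dvd_of_dvd (ZMod.dvd_unit_pow_sub_one hq u)
      (ZMod.dvd_unit_pow_sub_one hq u⁻¹)
    have h3 : (u : ZMod (q ^ 2)) ^ (q - 1) * ((u⁻¹ : (ZMod (q ^ 2))ˣ) : ZMod (q ^ 2)) ^ (q - 1)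
        = 1 := by
      rw [← mul_pow, ← Units.val_mul, mul_inv_cancel, Units.val_one, one_pow]
    linear_combination h3 - h1
  have hinv : ∑ u : (ZMod (q ^ 2))ˣ, ((u⁻¹ : (ZMod (q ^ 2))ˣ) : ZMod (q ^ 2)) ^ (q - 1) =
      ∑ u : (ZMod (q ^ 2))ˣ, (u : ZMod (q ^ 2)) ^ (q - 1) :=
    Fintype.sum_equiv (Equiv.inv _) _ _ fun u => rfl
  have hsum := sum_congr rfl fun u (_ : u ∈ (univ : Finset (ZMod (q ^ 2))ˣ)) => hpair u
  rw [sum_add_distrib, hinv, sum_const, card_univ, ZMod.card_units_eq_totient,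
    Nat.totient_prime_pow hq two_pos, nsmul_eq_mul] at hsum
  push_cast [hq.one_le] at hsum
  apply h2.mul_left_cancel
  linear_combination hsum + 2 * hqq

/-- Let `f` take values modulo `q²`, with `q` an odd prime. If every residue modulo `q` is attained
`p` times by `f`, then in the binomial expansion of `∑ (f s - f t) ^ (q - 1)` all the mixed terms
contain two power sums divisible by `q`, so that only the two pure powers contribute. -/
lemma sum_sum_sub_pow_sub_one {ι : Type*} {p : ℕ} (hq : q.Prime) (hq2 : q ≠ 2) (S : Finset ι)
    (f : ι → ZMod (q ^ 2)) (hf : ∀ r : ZMod q,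
      (S.filter fun s => ZMod.castHom (dvd_pow_self q two_ne_zero) (ZMod q) (f s) = r).card = p)
    (hS : S.card = p * q) :
    ∑ s ∈ S, ∑ t ∈ S, (f s - f t) ^ (q - 1) = -2 * (p : ZMod (q ^ 2)) ^ 2 * q := by
  have : NeZero (q ^ 2) := ⟨by have := hq.pos; positivity⟩
  have : Fact q.Prime := ⟨hq⟩
  set π := ZMod.castHom (dvd_pow_self q two_ne_zero) (ZMod q) with hπ
  have hπP (i : ℕ) : π (∑ s ∈ S, f s ^ i) = p * ∑ r : ZMod q, r ^ i := by
    rw [map_sum, ← sum_fiberwise S (fun s => π (f s)), mul_sum]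
    refine sum_congr rfl fun r _ => ?_
    rw [sum_congr rfl fun s hs => by rw [map_pow, (mem_filter.1 hs).2], sum_const, hf,
      nsmul_eq_mul]
  have hmid (i : ℕ) (hi : i < q - 1) : (q : ZMod (q ^ 2)) ∣ ∑ s ∈ S, f s ^ i := by
    rw [← ZMod.castHom_eq_zero_iff_dvd (dvd_pow_self q two_ne_zero), ← hπ, hπP,
      FiniteField.sum_pow_lt_card_sub_one (ZMod q) i (by rwa [ZMod.card]), mul_zero]
  have htop : (q : ZMod (q ^ 2)) ∣ ∑ s ∈ S, f s ^ (q - 1) + p := by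
    rw [← ZMod.castHom_eq_zero_iff_dvd (dvd_pow_self q two_ne_zero), ← hπ, map_add, hπP,
      map_natCast]
    have : ∑ r : ZMod q, r ^ (q - 1) = -1 := by
      have hr (r : ZMod q) : r ^ (q - 1) = 1 - if r = 0 then 1 else 0 := by
        split_ifs with h
        · rw [h, zero_pow (by have := hq.two_le; omega), sub_self]
        · rw [ZMod.pow_card_sub_one_eq_one h, sub_zero]
      simp [hr]
    rw [this]; ring
  have heven : Even (q - 1) := by
    rcases hq.eq_two_or_odd' with h | h
    · exact absurd h hq2
    · exact Nat.Odd.sub_odd h odd_one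
  have hq3 : 2 < q := lt_of_le_of_ne hq.two_le (Ne.symm hq2)
  have hexp : ∑ s ∈ S, ∑ t ∈ S, (f s - f t) ^ (q - 1) =
      ∑ i ∈ range (q - 1 + 1), (∑ s ∈ S, f s ^ i) * (∑ t ∈ S, f t ^ (q - 1 - i)) *
        ((-1) ^ (q - 1 - i) * ((q - 1).choose i : ZMod (q ^ 2))) := by
    have (s t : ι) : (f s - f t) ^ (q - 1) = ∑ i ∈ range (q - 1 + 1), f s ^ i * f t ^ (q - 1 - i) *
        ((-1) ^ (q - 1 - i) * ((q - 1).choose i : ZMod (q ^ 2))) := by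
      rw [sub_eq_add_neg, add_pow]
      refine sum_congr rfl fun i _ => ?_
      rw [neg_pow (f t)]; ring
    simp_rw [this]
    rw [sum_congr rfl fun s _ => sum_comm, sum_comm]
    refine sum_congr rfl fun i _ => ?_
    rw [sum_mul_sum, sum_mul]
    exact sum_congr rfl fun s _ => (sum_mul _ _ _).symm
  obtain ⟨k, hk⟩ : ∃ k, q - 1 = k + 1 := ⟨q - 2, by omega⟩
  have hmid0 : ∑ i ∈ range k, (∑ s ∈ S, f s ^ (i + 1)) * (∑ t ∈ S, f t ^ (q - 1 - (i + 1))) *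
        ((-1) ^ (q - 1 - (i + 1)) * ((q - 1).choose (i + 1) : ZMod (q ^ 2))) = 0 := by
    refine sum_eq_zero fun i hi => ?_
    rw [mem_range] at hi
    rw [ZMod.mul_eq_zero_of_dvd_of_dvd (hmid (i + 1) (by omega)) (hmid _ (by omega)), zero_mul]
  obtain ⟨c, hc⟩ := htop
  have hqq : ((q ^ 2 : ℕ) : ZMod (q ^ 2)) = 0 := ZMod.natCast_self _
  push_cast at hqq
  rw [hexp, sum_range_succ]
  have hr : range (q - 1) = range (k + 1) := by rw [hk]
  rw [hr, sum_range_succ', hmid0]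
  simp only [pow_zero, sum_const, nsmul_eq_mul, mul_one, tsub_zero, tsub_self, Nat.choose_self,
    Nat.choose_zero_right, Nat.cast_one, heven.neg_one_pow, hS, Nat.cast_mul]
  linear_combination 2 * p * q * hc + 2 * p * c * hqq

end PowerSum

/-! ### The arithmetic of the two primes -/

/-- If `S` has all units among its differences, then the common frequency of the residues prime to
`q` among its differences modulo `q²` is at least `p² - p`, because `p² - p` units of `ZMod N` lie
over each of them. In the case of equality a difference prime to `q` is a unit, so `p²` is not a
difference. -/
lemma le_foldedEnumerator_one {N : ℕ} [NeZero N] {S : Finset (ZMod N)} {p q : ℕ}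
    (hp : p.Prime) (hq : q.Prime) (hpq : p ≠ q) (hN : N = p ^ 2 * q ^ 2)
    (hinv : ∀ (u : (ZMod N)ˣ) y, weightEnumerator S (u * y) = weightEnumerator S y)
    (hpos : ∀ u : (ZMod N)ˣ, 0 < weightEnumerator S u) (hm : q ^ 2 ∣ N) :
    p * (p - 1) ≤ foldedEnumerator hm S 1 ∧ (foldedEnumerator hm S 1 = p * (p - 1) →
      weightEnumerator S ((p ^ 2 : ℕ) : ZMod N) = 0) := by
  classical
  have : NeZero (q ^ 2) := ⟨by have := hq.pos; positivity⟩
  have hcop : p.Coprime q := (Nat.coprime_primes hp hq).2 hpq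
  have hq1 : 0 < q * (q - 1) := Nat.mul_pos hq.pos (by have := hq.two_le; omega)
  have htot : (q ^ 2).totient = q * (q - 1) := by
    rw [Nat.totient_prime_pow hq two_pos]; simp
  have htotN : N.totient = q * (q - 1) * (p * (p - 1)) := by
    rw [hN, Nat.totient_mul (hcop.pow 2 2), htot, Nat.totient_prime_pow hp two_pos]
    simp [mul_comm]
  have hsum : q * (q - 1) * foldedEnumerator hm S 1 =
      ∑ x with IsUnit (ZMod.castHom hm (ZMod (q ^ 2)) x), weightEnumerator S x := by
    rw [← htot, ← sum_isUnit_foldedEnumerator hinv,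
      ← sum_fiberwise _ (ZMod.castHom hm (ZMod (q ^ 2))), sum_filter]
    refine sum_congr rfl fun j _ => ?_
    rw [filter_filter]
    split_ifs with hj
    · rw [foldedEnumerator]
      refine sum_congr (filter_congr fun x _ => ?_) fun _ _ => rfl
      exact ⟨fun hx => ⟨hx ▸ hj, hx⟩, fun hx => hx.2⟩
    · refine (sum_eq_zero fun x hx => ?_).symm
      obtain ⟨-, h1, h2⟩ := mem_filter.1 hx
      exact absurd (h2 ▸ h1) hj
  have hunits : N.totient ≤ ∑ x with IsUnit x, weightEnumerator S x := by
    rw [sum_filter_isUnit, ← ZMod.card_units_eq_totient, ← card_univ, card_eq_sum_ones]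
    exact sum_le_sum fun u _ => hpos u
  have hsub : (univ.filter fun x : ZMod N => IsUnit x) ⊆
      univ.filter fun x => IsUnit (ZMod.castHom hm (ZMod (q ^ 2)) x) := by
    intro x hx
    rw [mem_filter] at hx ⊢
    exact ⟨mem_univ _, hx.2.map _⟩
  rw [htotN] at hunits
  constructor
  · refine Nat.le_of_mul_le_mul_left ?_ hq1
    rw [hsum]
    exact hunits.trans (sum_le_sum_of_subset hsub)
  · intro heq
    rw [heq] at hsum
    have hnot : ¬ IsUnit (((p ^ 2 : ℕ) : ZMod N)) := by
      rw [ZMod.isUnit_iff_coprime, hN, Nat.coprime_mul_iff_right, Nat.coprime_self]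
      intro h
      exact hp.one_lt.ne' (by simpa using h.1)
    have hmem : ((p ^ 2 : ℕ) : ZMod N) ∈
        univ.filter fun x => IsUnit (ZMod.castHom hm (ZMod (q ^ 2)) x) := by
      rw [mem_filter, map_natCast, ZMod.isUnit_iff_coprime]
      exact ⟨mem_univ _, hcop.pow 2 2⟩
    have hins : insert ((p ^ 2 : ℕ) : ZMod N) (univ.filter fun x : ZMod N => IsUnit x) ⊆
        univ.filter fun x => IsUnit (ZMod.castHom hm (ZMod (q ^ 2)) x) :=
      insert_subset hmem hsub
    have hle := sum_le_sum_of_subset (f := weightEnumerator S) hins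
    rw [sum_insert (by simpa using hnot)] at hle
    omega

namespace FormallyDual

variable {N : ℕ} [NeZero N] {S T : Finset (ZMod N)} {p q : ℕ}

/-- Poisson summation over the subgroup of order `q`, whose nonzero elements are the unit multiples
of `p² q`, determines the number of pairs of elements of `S` that are congruent modulo `q`. -/
lemma mul_foldedEnumerator_zero (h : FormallyDual S T) (hp : p.Prime) (hq : q.Prime)
    (hN : N = p ^ 2 * q ^ 2) (hS : S.card = p * q) (hT : T.card = p * q) (hm : q ∣ N) :
    foldedEnumerator hm S 0 =
      p * (p * q + (q - 1) * weightEnumerator T ((p ^ 2 * q : ℕ) : ZMod N)) := by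
  have : NeZero q := ⟨hq.ne_zero⟩
  have : Fact q.Prime := ⟨hq⟩
  have hp0 := hp.pos
  have hq0 := hq.pos
  have hNM : N = (p ^ 2 * q) * q := by rw [hN]; ring
  set M := p ^ 2 * q
  have hnorm (y : ZMod N) : ‖charSum S y‖ ^ 2 = (p * q : ℝ) * weightEnumerator T y := by
    have := h.normSq_charSum_eq y
    rw [hS, hT] at this
    rw [this]
    push_cast
    have : (p : ℝ) ≠ 0 := by exact_mod_cast hp0.ne'
    have : (q : ℝ) ≠ 0 := by exact_mod_cast hq0.ne'
    field_simp
  have hk (k : ZMod q) (hk : k ≠ 0) :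
      weightEnumerator T ((M : ZMod N) * (k.val : ZMod N)) = weightEnumerator T (M : ZMod N) := by
    obtain ⟨u, hu⟩ := ZMod.unitsMap_surjective hm (Units.mk0 k hk)
    have huk : ZMod.castHom hm (ZMod q) u = k := congrArg Units.val hu
    have hd : (q : ZMod N) ∣ (k.val : ZMod N) - u := by
      rw [← ZMod.castHom_eq_zero_iff_dvd hm, map_sub, huk, map_natCast, ZMod.natCast_zmod_val,
        sub_self]
    obtain ⟨z, hz⟩ := hd
    have hMq : ((M * q : ℕ) : ZMod N) = 0 := by rw [← hNM]; simp
    push_cast at hMq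
    have : (M : ZMod N) * (k.val : ZMod N) = u * M := by
      linear_combination (M : ZMod N) * hz + z * hMq
    rw [this, h.weightEnumerator_unit_mul]
  have hsum := sum_normSq_charSum_natCast_mul hNM hm S
  simp_rw [hnorm] at hsum
  rw [← mul_sum, ← Nat.cast_sum, ← add_sum_erase _ _ (mem_univ (0 : ZMod q)),
    sum_congr rfl fun k hk' => hk k (ne_of_mem_erase hk')] at hsum
  rw [ZMod.val_zero, Nat.cast_zero, mul_zero, weightEnumerator_zero, hT, sum_const,
    card_erase_of_mem (mem_univ _), card_univ, ZMod.card, smul_eq_mul] at hsum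
  have hsum' : p * q * (p * q + (q - 1) * weightEnumerator T (M : ZMod N)) =
      q * foldedEnumerator hm S 0 := by exact_mod_cast hsum
  refine Nat.eq_of_mul_eq_mul_left hq0 ?_
  rw [← hsum']; ring

/-- The residues prime to `q` are equally frequent among the differences of `S` modulo `q²`, and
their frequency is determined by the value of the difference function of `T` at the elements of
order `q`. -/
lemma mul_foldedEnumerator_one (h : FormallyDual S T) (hp : p.Prime) (hq : q.Prime)
    (hN : N = p ^ 2 * q ^ 2) (hS : S.card = p * q) (hT : T.card = p * q) (hm : q ^ 2 ∣ N) :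
    q * foldedEnumerator hm S 1 + p * weightEnumerator T ((p ^ 2 * q : ℕ) : ZMod N) =
      p ^ 2 * q := by
  have hm' : q ∣ N := (dvd_pow_self q two_ne_zero).trans hm
  have h1 := card_sq_eq_foldedEnumerator hq hm hm' h.symm.weightEnumerator_unit_mul
  rw [h.mul_foldedEnumerator_zero hp hq hN hS hT hm', hS] at h1
  obtain ⟨r, rfl⟩ : ∃ r, q = r + 2 := ⟨q - 2, by have := hq.two_le; omega⟩
  rw [show r + 2 - 1 = r + 1 by omega] at h1
  refine Nat.eq_of_mul_eq_mul_left r.succ_pos ?_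
  zify at h1 ⊢
  linear_combination -h1

/-- If the Fourier transform of `T` vanishes at the characters of order `q²`, then the distribution
of `T` modulo `q²` is invariant under translation by `q`, so that every residue modulo `q²` is the
difference of a multiple of `q` pairs. -/
lemma dvd_foldedEnumerator_one (h : FormallyDual T S) (hq : q.Prime)
    (hN : N = p ^ 2 * q ^ 2) (hm : q ^ 2 ∣ N)
    (h0 : weightEnumerator S ((p ^ 2 : ℕ) : ZMod N) = 0) : q ∣ foldedEnumerator hm T 1 := by
  classical
  have : NeZero (q ^ 2) := ⟨by have := hq.pos; positivity⟩
  set π := ZMod.castHom hm (ZMod (q ^ 2)) with hπ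
  let μ : ZMod (q ^ 2) → ℕ := fun j => (T.filter fun t => π t = j).card
  have hsum {M : Type} [AddCommMonoid M] (F : ZMod (q ^ 2) → M) :
      ∑ t ∈ T, F (π t) = ∑ j, μ j • F j := by
    rw [← sum_fiberwise T π]
    refine sum_congr rfl fun j _ => ?_
    rw [← sum_const]
    exact sum_congr rfl fun t ht => by rw [(mem_filter.1 ht).2]
  have hdft (k : ZMod (q ^ 2)) :
      ZMod.dft (fun j => (μ j : ℂ)) k = 0 ∨ (q : ZMod (q ^ 2)) * k = 0 := by
    by_cases hk : IsUnit k
    · left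
      obtain ⟨u, hu⟩ := ZMod.unitsMap_surjective hm (-hk.unit)
      have huk : π u = -k := congrArg Units.val hu
      have hz := h.charSum_unit_mul_eq_zero u ((h.weightEnumerator_eq_zero_iff _).1 h0)
      rw [mul_comm, charSum_natCast_mul hN hm, ← hπ, huk,
        hsum (fun j => (ZMod.stdAddChar (j * -k) : ℂ))] at hz
      rw [ZMod.dft_apply, ← hz]
      refine sum_congr rfl fun j _ => ?_
      rw [smul_eq_mul, nsmul_eq_mul, mul_neg, mul_comm]
    · right
      rw [ZMod.isUnit_iff_not_dvd_of_sq hq, not_not] at hk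
      exact ZMod.mul_eq_zero_of_dvd_of_dvd dvd_rfl hk
  have hper (j : ZMod (q ^ 2)) : μ (j + (q : ZMod (q ^ 2))) = μ j := by
    exact_mod_cast periodic_of_dft_eq_zero hdft j
  have hA : foldedEnumerator hm T 1 = ∑ j, μ (j + 1) * μ j := by
    have h1 := sum_sum_castHom_sub_eq hm T (fun j => if j = 1 then (1 : ℕ) else 0)
    simp only [smul_eq_mul, mul_ite, mul_one, mul_zero, sum_ite_eq', mem_univ, if_true] at h1
    rw [← h1, sum_comm, sum_congr rfl fun t _ => ?_,
      hsum (fun j => μ (j + 1))]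
    · exact sum_congr rfl fun j _ => by rw [smul_eq_mul, mul_comm]
    · rw [← card_filter]
      congr 1
      refine filter_congr fun s _ => ?_
      rw [sub_eq_iff_eq_add, add_comm]
  have hord : addOrderOf ((q : ℕ) : ZMod (q ^ 2)) = q := by
    rw [ZMod.addOrderOf_coe _ (NeZero.ne _), sq, Nat.gcd_mul_left_left,
      Nat.mul_div_cancel_left _ hq.pos]
  rw [hA]
  have := addOrderOf_dvd_sum_of_periodic (f := fun j => μ (j + 1) * μ j)
    (a := ((q : ℕ) : ZMod (q ^ 2))) (fun j => by rw [add_right_comm, hper, hper])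
  rwa [hord] at this

/-- If the difference function of `T` vanishes at the elements of order `q`, then `S` is equally
distributed modulo `q`, and comparing power sums of differences modulo `q²` shows `q = 2`. -/
lemma eq_two_of_weightEnumerator_eq_zero (h : FormallyDual S T) (hp : p.Prime) (hq : q.Prime)
    (hpq : p ≠ q) (hN : N = p ^ 2 * q ^ 2) (hS : S.card = p * q) (hT : T.card = p * q)
    (h0 : weightEnumerator T ((p ^ 2 * q : ℕ) : ZMod N) = 0) : q = 2 := by
  classical
  by_contra hq2
  have hm : q ^ 2 ∣ N := hN ▸ dvd_mul_left _ _
  have hm' : q ∣ N := (dvd_pow_self q two_ne_zero).trans hm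
  have : NeZero (q ^ 2) := ⟨by have := hq.pos; positivity⟩
  have : NeZero q := ⟨hq.ne_zero⟩
  have hA := h.mul_foldedEnumerator_one hp hq hN hS hT hm
  have hE := h.mul_foldedEnumerator_zero hp hq hN hS hT hm'
  rw [h0, mul_zero, add_zero] at hA hE
  have hA' : foldedEnumerator hm S 1 = p ^ 2 :=
    Nat.eq_of_mul_eq_mul_left hq.pos (hA.trans (mul_comm _ _))
  -- the variance of the distribution of `S` modulo `q` is zero
  let μ : ZMod q → ℕ := fun r => (S.filter fun s => ZMod.castHom hm' (ZMod q) s = r).card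
  have hμ1 : ∑ r, μ r = p * q := by
    rw [← hS, ← card_eq_sum_card_fiberwise fun _ _ => mem_univ _]
  have hμ2 : ∑ r, μ r * μ r = p * (p * q) := by
    rw [← hE]
    have h1 := sum_sum_castHom_sub_eq hm' S (fun j => if j = 0 then (1 : ℕ) else 0)
    simp only [smul_eq_mul, mul_ite, mul_one, mul_zero, sum_ite_eq', mem_univ, if_true] at h1
    rw [← h1, ← sum_fiberwise S (ZMod.castHom hm' (ZMod q))]
    refine sum_congr rfl fun r _ => ?_
    rw [← smul_eq_mul, ← sum_const]
    refine sum_congr rfl fun s hs => ?_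
    rw [(mem_filter.1 hs).2, ← card_filter]
    refine congrArg card (filter_congr fun t _ => ?_)
    rw [sub_eq_zero, eq_comm]
  have hvar : ∑ r, ((μ r : ℤ) - p) ^ 2 = 0 := by
    have e1 : ∑ r, (μ r : ℤ) = p * q := by exact_mod_cast hμ1
    have e2 : ∑ r, (μ r : ℤ) * μ r = p * (p * q) := by exact_mod_cast hμ2
    have (r : ZMod q) : ((μ r : ℤ) - p) ^ 2 = (μ r : ℤ) * μ r - 2 * p * μ r + p ^ 2 := by ring
    simp_rw [this]
    rw [sum_add_distrib, sum_sub_distrib, ← mul_sum, e1, e2]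
    simp only [sum_const, card_univ, ZMod.card, nsmul_eq_mul]
    ring
  have hμ (r : ZMod q) : μ r = p := by
    have := (sum_eq_zero_iff_of_nonneg fun r _ => sq_nonneg _).1 hvar r (mem_univ r)
    have := pow_eq_zero_iff two_ne_zero |>.1 this
    omega
  have hpow := sum_sum_sub_pow_sub_one (p := p) hq hq2 S (ZMod.castHom hm (ZMod (q ^ 2)))
    (fun r => by
      rw [← hμ r]
      refine congrArg card (filter_congr fun s _ => ?_)
      rw [← RingHom.comp_apply, Subsingleton.elim ((ZMod.castHom (dvd_pow_self q two_ne_zero)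
        (ZMod q)).comp (ZMod.castHom hm (ZMod (q ^ 2)))) (ZMod.castHom hm' (ZMod q))]) hS
  have hnon (j : ZMod (q ^ 2)) (hj : ¬ IsUnit j) : j ^ (q - 1) = 0 := by
    rw [ZMod.isUnit_iff_not_dvd_of_sq hq, not_not] at hj
    obtain ⟨k, hk⟩ : ∃ k, q - 1 = k + 2 := ⟨q - 3, by have := hq.two_le; omega⟩
    rw [hk, pow_add, pow_two j, ZMod.mul_eq_zero_of_dvd_of_dvd hj hj, mul_zero]
  rw [sum_sum_castHom_sub_eq hm S (fun j => j ^ (q - 1)),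
    ← sum_filter_add_sum_filter_not univ IsUnit,
    sum_eq_zero (s := univ.filter fun j => ¬ IsUnit j)
      (fun j hj => by rw [hnon j (mem_filter.1 hj).2, smul_zero]), add_zero,
    sum_filter_isUnit] at hpow
  have hconst (u : (ZMod (q ^ 2))ˣ) : foldedEnumerator hm S u = p ^ 2 := by
    rw [← hA']
    simpa using foldedEnumerator_unit_mul (hm := hm) h.symm.weightEnumerator_unit_mul u 1
  simp_rw [hconst] at hpow
  rw [← smul_sum, ZMod.sum_units_pow_sub_one hq hq2, nsmul_eq_mul] at hpow
  have hz : ((p ^ 2 * q : ℕ) : ZMod (q ^ 2)) = 0 := by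
    push_cast at hpow ⊢
    linear_combination hpow
  rw [ZMod.natCast_eq_zero_iff, sq q] at hz
  have := Nat.dvd_of_mul_dvd_mul_right hq.pos hz
  exact hpq ((Nat.prime_dvd_prime_iff_eq hq hp).1 (hq.dvd_of_dvd_pow this)).symm

/-- The difference functions of `S` and `T` take the value `0` or `q` at the elements of order `q`:
the value `0` for `T` forces `q = 2`, and the value `q` forces `q ∣ p - 1`. -/
lemma eq_two_or_dvd_sub_one (h : FormallyDual S T) (hSp : IsPrimitiveSubset S)
    (hTp : IsPrimitiveSubset T) (hp : p.Prime) (hq : q.Prime) (hpq : p ≠ q)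
    (hN : N = p ^ 2 * q ^ 2) : q = 2 ∨ q ∣ p - 1 := by
  obtain ⟨hS, hT⟩ := h.card_eq_mul hSp hTp hp hq hpq hN
  have hm : q ^ 2 ∣ N := hN ▸ dvd_mul_left _ _
  have hcop : q.Coprime p := (Nat.coprime_primes hq hp).2 hpq.symm
  obtain ⟨hgeS, heqS⟩ := le_foldedEnumerator_one hp hq hpq hN h.symm.weightEnumerator_unit_mul
    (h.symm.weightEnumerator_unit_pos hSp hp hq hpq hN hT) hm
  obtain ⟨hgeT, -⟩ := le_foldedEnumerator_one hp hq hpq hN h.weightEnumerator_unit_mul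
    (h.weightEnumerator_unit_pos hTp hp hq hpq hN hS) hm
  have hA := h.mul_foldedEnumerator_one hp hq hN hS hT hm
  have hB := h.symm.mul_foldedEnumerator_one hp hq hN hT hS hm
  obtain ⟨r, rfl⟩ : ∃ r, p = r + 1 := ⟨p - 1, by have := hp.pos; omega⟩
  rw [Nat.add_sub_cancel] at *
  -- either value of the difference function at the elements of order `q` is `0` or `q`
  have hdich {A c : ℕ} (hA : q * A + (r + 1) * c = (r + 1) ^ 2 * q) (hge : (r + 1) * r ≤ A) :
      (c = 0 ∧ A = (r + 1) ^ 2) ∨ (c = q ∧ A = (r + 1) * r) := by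
    have hd : q ∣ (r + 1) * c :=
      (Nat.dvd_add_right (dvd_mul_right q A)).1 (hA ▸ dvd_mul_left q _)
    obtain ⟨y, rfl⟩ := hcop.dvd_of_dvd_mul_left hd
    have h1 : A + (r + 1) * y = (r + 1) ^ 2 := by
      refine Nat.eq_of_mul_eq_mul_left hq.pos ?_
      linarith
    have hy : y ≤ 1 := by
      refine Nat.le_of_mul_le_mul_left ?_ r.succ_pos
      nlinarith
    interval_cases y
    · exact Or.inl ⟨mul_zero q, by simpa using h1⟩
    · exact Or.inr ⟨mul_one q, by nlinarith⟩
  rcases hdich hA hgeS with ⟨hc, -⟩ | ⟨-, hA'⟩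
  · exact Or.inl (h.eq_two_of_weightEnumerator_eq_zero hp hq hpq hN hS hT hc)
  · right
    have hd := dvd_foldedEnumerator_one h.symm hq hN hm (heqS hA')
    rcases hdich hB hgeT with ⟨-, hB'⟩ | ⟨-, hB'⟩
    · rw [hB'] at hd
      exact absurd ((Nat.prime_dvd_prime_iff_eq hq hp).1 (hq.dvd_of_dvd_pow hd)).symm hpq
    · rw [hB'] at hd
      exact hcop.dvd_of_dvd_mul_left hd

end FormallyDual

/-! ### Conclusion -/

theorem mainTheorem3 (p q : ℕ) [Fact p.Prime] [Fact q.Prime] (hpq : p ≠ q) :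
    ¬ ∃ S T : Finset (ZMod (p ^ 2 * q ^ 2)),
      IsPrimitiveSubset S ∧ IsPrimitiveSubset T ∧ FormallyDual S T := by
  rintro ⟨S, T, hS, hT, h⟩
  have hp : p.Prime := Fact.out
  have hq : q.Prime := Fact.out
  have hp2 := hp.two_le
  have hq2 := hq.two_le
  have h1 := h.eq_two_or_dvd_sub_one hS hT hp hq hpq rfl
  have h2 := h.eq_two_or_dvd_sub_one hS hT hq hp hpq.symm (mul_comm _ _)
  have h3 : q = 2 ∨ q ≤ p - 1 := h1.imp_right (Nat.le_of_dvd (by omega))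
  have h4 : p = 2 ∨ p ≤ q - 1 := h2.imp_right (Nat.le_of_dvd (by omega))
  omega
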